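/- Let $P$ be an arbitrary tetrahedron in $\mathbb R^3$ with a face $ABC$ chosen as its base and opposite vertex $O$, its apex. Cut off the apex by a plane parallel to the base that meets the edges $OA, OB, OC$ in interior points $T_A, T_B, T_C$ (the top cut). Choose points $p_a, p_b, p_c$ in the relative interiors of the segments $T_AA$, $T_BB$, $T_CC$, and let $l_a, l_b, l_c$ be three parallel lines through $p_a, p_b, p_c$, each of which meets the relative interior of the triangle $ABC$. Make six side cuts, in three parallel pairs: the planes through $l_a$ and through $l_b$ parallel to $OC$, cutting off $A$ and $B$ respectively; the planes through $l_a$ and through $l_c$ parallel to $OB$, cutting off $A$ and $C$ respectively; and the planes through $l_b$ and through $l_c$ parallel to $OA$, cutting off $B$ and $C$ respectively. (Each cut removes from $P$ the points strictly on the side of its plane that contains the vertex cut off.) Let $P'$ be the remaining set, and suppose that a part of positive length of each of the three base edges $AB$, $AC$, $BC$ remains in $P'$. Such a $P'$ is called an equitruncated tetrahedron. **Theorem.** Every equitruncated tetrahedron $P'$ is $10$-equiprojective: $P'$ is a convex polyhedron, and its orthogonal projection along every direction that is not parallel to a face of $P'$ is a convex polygon with exactly $10$ edges. -/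

import Mathlib

/-- Euclidean three-space. -/
abbrev E3 : Type := EuclideanSpace ℝ (Fin 3)

/-! ### Polyhedra, shadows and equiprojectivity -/

/-- A (bounded, three-dimensional) convex polyhedron: a bounded set with nonempty interior that is
the intersection of finitely many closed half-spaces `{x | f x ≤ b}`, `f ≠ 0`. -/
def IsConvexPolyhedron (P : Set E3) : Prop :=
  (∃ H : Finset (StrongDual ℝ E3 × ℝ), (∀ h ∈ H, h.1 ≠ 0) ∧ P = {x | ∀ h ∈ H, h.1 x ≤ h.2}) ∧
    Bornology.IsBounded P ∧ (interior P).Nonempty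

/-- `F` is a face (two-dimensional, as in "vertices, edges, faces") of `P`. -/
def IsPolyhedronFace (P F : Set E3) : Prop :=
  IsExposed ℝ P F ∧ Module.finrank ℝ (vectorSpan ℝ F) = 2

/-- `S` is a convex `k`-gon: a two-dimensional set that is the convex hull of exactly `k` points in
convex position (its vertices). -/
def IsConvexGon (k : ℕ) (S : Set E3) : Prop :=
  ∃ V : Finset E3, V.card = k ∧ ConvexIndependent ℝ ((↑) : V → E3) ∧
    S = convexHull ℝ (V : Set E3) ∧ Module.finrank ℝ (vectorSpan ℝ S) = 2

/-- The shadow of `P` in direction `v`: its orthogonal projection onto the plane `vᗮ`. -/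
noncomputable def polyhedronShadow (v : E3) (P : Set E3) : Set E3 :=
  (ℝ ∙ v)ᗮ.starProjection '' P

/-- `P` is a `k`-equiprojective polyhedron: its shadow is a `k`-gon in every direction that is not
parallel to a face of `P`. -/
def IsEquiprojective (k : ℕ) (P : Set E3) : Prop :=
  IsConvexPolyhedron P ∧
    ∀ v : E3, v ≠ 0 → (∀ F : Set E3, IsPolyhedronFace P F → v ∉ vectorSpan ℝ F) →
      IsConvexGon k (polyhedronShadow v P)

/-! ### The equitruncated tetrahedron -/

/-- The part of space that a cut along the plane `Q` removes when it cuts off the point `v`: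
the open half-space of `Q` that contains `v`. -/
def cutOff (Q : AffineSubspace ℝ E3) (v : E3) : Set E3 :=
  {x | Q.SSameSide v x}

/-- The plane of the top cut: through the point `T` on the edge `OA`, parallel to the base. -/
noncomputable def topPlane (A B C T : E3) : AffineSubspace ℝ E3 :=
  AffineSubspace.mk' T (Submodule.span ℝ {B - A, C - A})

/-- The plane that contains the line through `p` with direction `d` and is parallel to the
edge `OX`. -/
noncomputable def sidePlane (O X p d : E3) : AffineSubspace ℝ E3 :=
  AffineSubspace.mk' p (Submodule.span ℝ {d, X - O})

/-- The result of the cuts: from the tetrahedron with apex `O` and base `ABC`, the top cut through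
`T` cuts off the apex, and six side cuts cut off base vertices. The side cuts come in three parallel
pairs; the pair of cuts through the lines with direction `d` at the points on two of the edges
`OA`, `OB`, `OC` is parallel to the third of these edges. -/
def truncatedTetrahedron (O A B C T pa pb pc d : E3) : Set E3 :=
  convexHull ℝ {O, A, B, C} \
    (cutOff (topPlane A B C T) O ∪
      (cutOff (sidePlane O C pa d) A ∪ cutOff (sidePlane O C pb d) B) ∪
      (cutOff (sidePlane O B pa d) A ∪ cutOff (sidePlane O B pc d) C) ∪
      (cutOff (sidePlane O A pb d) B ∪ cutOff (sidePlane O A pc d) C))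

/-- The relative interior of the triangle `ABC`. -/
def openTriangle (A B C : E3) : Set E3 :=
  {x | ∃ u v w : ℝ, 0 < u ∧ 0 < v ∧ 0 < w ∧ u + v + w = 1 ∧ x = u • A + v • B + w • C}

/-- The line through `p` with direction `d` properly intersects the base `ABC`: it meets the
relative interior of the triangle. -/
def LineMeetsBase (A B C p d : E3) : Prop :=
  ∃ s : ℝ, p + s • d ∈ openTriangle A B C

/-- `P'` is an equitruncated tetrahedron, obtained from an arbitrary tetrahedron with apex `O` and
base `ABC`. The top cut meets each edge `OX` in the point `lineMap O X t`, and `pa`, `pb`, `pc` are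
points in the interior of the parts of the edges that the top cut leaves. -/
def IsEquitruncatedTetrahedron (P' : Set E3) : Prop :=
  ∃ (O A B C : E3) (t : ℝ) (pa pb pc d : E3),
    AffineIndependent ℝ ![O, A, B, C] ∧
    0 < t ∧ t < 1 ∧
    pa ∈ openSegment ℝ (AffineMap.lineMap O A t) A ∧
    pb ∈ openSegment ℝ (AffineMap.lineMap O B t) B ∧
    pc ∈ openSegment ℝ (AffineMap.lineMap O C t) C ∧
    d ≠ 0 ∧
    LineMeetsBase A B C pa d ∧ LineMeetsBase A B C pb d ∧ LineMeetsBase A B C pc d ∧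
    P' = truncatedTetrahedron O A B C (AffineMap.lineMap O A t) pa pb pc d ∧
    -- a part of positive length of each of the three old edges of the base remains
    (segment ℝ A B ∩ P').Nontrivial ∧
    (segment ℝ A C ∩ P').Nontrivial ∧
    (segment ℝ B C ∩ P').Nontrivial

/-!
An equitruncated tetrahedron is described in coordinates with the apex as origin and the basis
vectors along the edges at the apex, scaled so that the chosen lines have direction `(1, 1, 1)`.
It is then the set of `x` with `0 ≤ x i`, `t ≤ ∑ i, w i * x i ≤ 1` and `x i - x j ≤ a i`, where
`w` and `a` satisfy strict inequalities which say that the fifteen vertices are in general position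
(`IsEquitruncatedTetrahedron.exists_eq_solid`). The eleven bounding planes have normals
`± e i`, `± w` and `e i - e j`, and each of them contains a face
(`CutData.isPolyhedronFace`), so that a direction `v` that is not parallel to a face has distinct
nonzero coordinates and `∑ i, w i * v i ≠ 0`.

An edge casts an edge of the shadow if and only if the normals of its two faces have products of
opposite signs with `v`. By replacing `v` by `-v` and by permuting the coordinates one may suppose
that `∑ i, w i * v i` is positive and that `v 0 < v 1 < v 2`. Then `v 2` is positive, and the signs
of all products are known except those of `v 0` and `v 1`. In each of the three remaining cases the
silhouette is a cycle of ten edges (`CutData.isConvexGon_of_increasing`).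

That the cycle bounds the shadow is a general fact
(`isConvexGon_polyhedronShadow_of_silhouette`): for an edge of the silhouette, the positive
combination of the two face normals that vanishes at `v` is a functional on the plane of the shadow
which attains its maximum over the polyhedron along that edge. If a functional on the plane
separated a point of the shadow from the vertices of the cycle, it would be, where it is largest on
the cycle, a nonnegative combination of the functionals of the two edges meeting there, and the
point would violate one of them.
-/

/-! ### Convexity of planar shadows -/

/-- Functionals on three-space that vanish at `v` form a plane, spanned by any two of them that
separate two directions `u` and `w`. -/
theorem eq_combination_of_apply_eq_zero {v u w : E3} (hv : v ≠ 0) {f G G' : StrongDual ℝ E3}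
    (hf : f v = 0) (hGv : G v = 0) (hGv' : G' v = 0) (hGu : G u = 0) (hGw : G w ≠ 0)
    (hGu' : G' u ≠ 0) (hGw' : G' w = 0) :
    f = (f w / G w) • G + (f u / G' u) • G' := by
  have hli : LinearIndependent ℝ ![v, u, w] := by
    rw [Fintype.linearIndependent_iff]
    intro c hc
    simp only [Fin.sum_univ_three, Matrix.cons_val_zero, Matrix.cons_val_one,
      Matrix.cons_val] at hc
    have h2 : c 2 = 0 := by
      have := congrArg G hc
      simpa [hGv, hGu, hGw] using this
    have h1 : c 1 = 0 := by
      have := congrArg G' hc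
      simpa [hGv', hGw', hGu'] using this
    have h0 : c 0 = 0 := by simpa [h1, h2, hv] using hc
    intro i
    fin_cases i <;> assumption
  have hspan := hli.span_eq_top_of_card_eq_finrank' (by simp)
  apply ContinuousLinearMap.coe_injective
  refine LinearMap.ext_on hspan ?_
  rintro _ ⟨i, rfl⟩
  fin_cases i
  · simp [hf, hGv, hGv']
  · simp [hGu, hGu']
  · simp [hGw, hGw']

/-- The shadow map identifies points that differ by a multiple of the direction of projection. -/
theorem apply_starProjection_of_apply_eq_zero {v : E3} {f : StrongDual ℝ E3} (hf : f v = 0)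
    (x : E3) : f ((ℝ ∙ v)ᗮ.starProjection x) = f x := by
  have h := Submodule.sub_starProjection_mem_orthogonal (K := (ℝ ∙ v)ᗮ) x
  rw [Submodule.orthogonal_orthogonal, Submodule.mem_span_singleton] at h
  obtain ⟨r, hr⟩ := h
  have := congrArg f hr
  rw [map_smul, hf, smul_zero, map_sub] at this
  linarith

theorem starProjection_orthogonal_span_self (v : E3) : (ℝ ∙ v)ᗮ.starProjection v = 0 := by
  rw [Submodule.starProjection_orthogonal]
  simp [Submodule.starProjection_eq_self_iff.2 (Submodule.mem_span_singleton_self v)]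

/-- If every direction in `W` can be followed a little from a point of `S`, then `W` lies in the
vector span of `S`. -/
theorem le_vectorSpan_of_forall_exists_add_smul_mem {S : Set E3} {x : E3} (hx : x ∈ S)
    {W : Submodule ℝ E3} (h : ∀ u ∈ W, ∃ ε : ℝ, 0 < ε ∧ x + ε • u ∈ S) :
    W ≤ vectorSpan ℝ S := by
  intro u hu
  obtain ⟨ε, hε, hxu⟩ := h u hu
  have := vsub_mem_vectorSpan ℝ hxu hx
  rw [vsub_eq_sub, add_sub_cancel_left] at this
  exact (Submodule.smul_mem_iff _ hε.ne').1 this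

theorem exists_pos_add_smul_mem_of_mem_interior {S : Set E3} {x : E3} (hx : x ∈ interior S)
    (u : E3) : ∃ ε : ℝ, 0 < ε ∧ x + ε • u ∈ S := by
  have hc : Filter.Tendsto (fun ε : ℝ => x + ε • u) (nhdsWithin 0 (Set.Ioi 0)) (nhds x) := by
    have : Continuous fun ε : ℝ => x + ε • u := by fun_prop
    simpa using (this.tendsto 0).mono_left nhdsWithin_le_nhds
  have h := hc.eventually (mem_interior_iff_mem_nhds.1 hx)
  obtain ⟨ε, h1, h2⟩ := (h.and self_mem_nhdsWithin).exists
  exact ⟨ε, h2, h1⟩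

theorem finrank_vectorSpan_polyhedronShadow {v : E3} (hv : v ≠ 0) {P : Set E3}
    (hP : (interior P).Nonempty) :
    Module.finrank ℝ (vectorSpan ℝ (polyhedronShadow v P)) = 2 := by
  obtain ⟨x, hx⟩ := hP
  have : Fact (Module.finrank ℝ E3 = 2 + 1) := ⟨by simp⟩
  rw [← Submodule.finrank_orthogonal_span_singleton (𝕜 := ℝ) (n := 2) hv]
  have : vectorSpan ℝ (polyhedronShadow v P) = (ℝ ∙ v)ᗮ := by
    apply le_antisymm
    · rw [vectorSpan_def, Submodule.span_le]
      rintro _ ⟨_, ⟨y, -, rfl⟩, _, ⟨z, -, rfl⟩, rfl⟩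
      exact Submodule.sub_mem _ (Submodule.starProjection_apply_mem _ _)
        (Submodule.starProjection_apply_mem _ _)
    · refine le_vectorSpan_of_forall_exists_add_smul_mem
        (x := (ℝ ∙ v)ᗮ.starProjection x) (Set.mem_image_of_mem _ (interior_subset hx)) ?_
      intro u hu
      obtain ⟨ε, hε, h⟩ := exists_pos_add_smul_mem_of_mem_interior hx u
      refine ⟨ε, hε, x + ε • u, h, ?_⟩
      rw [map_add, map_smul, Submodule.starProjection_eq_self_iff.2 hu]
  rw [this]

/-- Support functionals `G i`, constant along the direction `v` of projection, each attaining its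
maximum over the points `Q j` exactly at `Q i` and `Q (next i)`, certify that the shadow is the
polygon whose vertices are the shadows of the points `Q i`.

The shadow lies in the convex hull of the vertices since a separating functional, which is largest
among the vertices at the shadow of `Q k` say, is a nonnegative combination of the two support
functionals at `Q k`. -/
theorem isConvexGon_polyhedronShadow_of_support {ι : Type*} [Fintype ι] [Nonempty ι]
    (next : Equiv.Perm ι) (hn : ∀ i, next i ≠ i) (hnn : ∀ i, next (next i) ≠ i)
    {v : E3} (hv : v ≠ 0) {P : Set E3} (hPc : Convex ℝ P) (hPi : (interior P).Nonempty)
    (Q : ι → E3) (hQ : ∀ i, Q i ∈ P) (G : ι → StrongDual ℝ E3) (c : ι → ℝ)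
    (hGv : ∀ i, G i v = 0) (hG : ∀ i, ∀ x ∈ P, G i x ≤ c i)
    (hGQ : ∀ i j, G i (Q j) = c i ↔ j = i ∨ j = next i) :
    IsConvexGon (Fintype.card ι) (polyhedronShadow v P) := by
  classical
  set π := (ℝ ∙ v)ᗮ.starProjection with hπ
  have hself (i) : G i (Q i) = c i := (hGQ i i).2 (Or.inl rfl)
  have hnext (i) : G i (Q (next i)) = c i := (hGQ i _).2 (Or.inr rfl)
  have hlt {i j} (h1 : j ≠ i) (h2 : j ≠ next i) : G i (Q j) < c i :=
    lt_of_le_of_ne (hG i _ (hQ j)) fun h => ((hGQ i j).1 h).elim h1 h2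
  -- the sum of the two support functionals at a vertex exposes that vertex
  have hexp (i j : ι) (hij : j ≠ next i) :
      (G i + G (next i)) (Q j) < (G i + G (next i)) (Q (next i)) := by
    simp only [add_apply, hnext, hself]
    by_cases h : j = i
    · subst h
      have := hlt (i := next j) (j := j) hij (hnn j).symm
      linarith [hself j]
    · have := hlt h hij
      linarith [hG (next i) _ (hQ j)]
  have hexp0 (i) : (G i + G (next i)) v = 0 := by simp [hGv]
  have hinj : Function.Injective fun i => π (Q i) := by
    intro i j hij
    by_contra hne
    obtain ⟨i, rfl⟩ := next.surjective i
    have := hexp i j (fun h => hne h.symm)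
    rw [← apply_starProjection_of_apply_eq_zero (hexp0 i) (Q j),
      ← apply_starProjection_of_apply_eq_zero (hexp0 i) (Q (next i))] at this
    simp only [← hπ] at this
    simp only at hij
    rw [hij] at this
    exact lt_irrefl _ this
  refine ⟨Finset.univ.image fun i => π (Q i), ?_, ?_, ?_,
    finrank_vectorSpan_polyhedronShadow hv hPi⟩
  · rw [Finset.card_image_of_injective _ hinj, Finset.card_univ]
  · have := (convexIndependent_set_iff_notMem_convexHull_sdiff (𝕜 := ℝ)
      (s := ((Finset.univ.image fun i => π (Q i) : Finset E3) : Set E3))).2 ?_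
    · exact this
    intro x hx hmem
    simp only [Finset.coe_image, Finset.coe_univ, Set.image_univ, Set.mem_range] at hx
    obtain ⟨i, rfl⟩ := hx
    obtain ⟨i, rfl⟩ := next.surjective i
    have hsub : convexHull ℝ (((Finset.univ.image fun i => π (Q i) : Finset E3) : Set E3) \
        {π (Q (next i))}) ⊆
        {x | (G i + G (next i)) x < (G i + G (next i)) (π (Q (next i)))} := by
      refine convexHull_min ?_ (convex_halfSpace_lt (G i + G (next i)).isLinear _)
      rintro y ⟨hy, hy'⟩
      simp only [Finset.coe_image, Finset.coe_univ, Set.image_univ, Set.mem_range] at hy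
      obtain ⟨j, rfl⟩ := hy
      have := hexp i j (fun h => hy' (by rw [h]; rfl))
      rw [← apply_starProjection_of_apply_eq_zero (hexp0 i) (Q j),
        ← apply_starProjection_of_apply_eq_zero (hexp0 i) (Q (next i))] at this
      exact this
    exact (lt_irrefl ((G i + G (next i)) (π (Q (next i))))) (hsub hmem)
  · apply Set.Subset.antisymm
    · rintro _ ⟨x, hx, rfl⟩
      by_contra hnot
      obtain ⟨f, r, hf, hfx⟩ := geometric_hahn_banach_closed_point (convex_convexHull ℝ _)
        (Set.Finite.isCompact_convexHull ℝ (Finset.finite_toSet _)).isClosed hnot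
      set g : StrongDual ℝ E3 := f.comp π with hg
      have hgv : g v = 0 := by
        rw [hg, ContinuousLinearMap.comp_apply, hπ, starProjection_orthogonal_span_self, map_zero]
      have hgx : r < g x := hfx
      have hgQ (i) : g (Q i) < r := hf _ (subset_convexHull ℝ _ (by simp [hπ]))
      obtain ⟨k, hk⟩ := Finite.exists_max fun i => g (Q i)
      obtain ⟨k, rfl⟩ := next.surjective k
      have hu : G k (Q (next (next k)) - Q (next k)) < 0 := by
        have := hlt (i := k) (j := next (next k)) (hnn k) (hn (next k))
        rw [map_sub, hnext]; linarith
      have hw : G (next k) (Q k - Q (next k)) < 0 := by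
        have := hlt (i := next k) (j := k) (hn k).symm (hnn k).symm
        rw [map_sub, hself]; linarith
      have hcomb := eq_combination_of_apply_eq_zero hv hgv (hGv (next k)) (hGv k)
        (u := Q (next (next k)) - Q (next k)) (w := Q k - Q (next k))
        (by rw [map_sub, hnext, hself, sub_self]) hw.ne hu.ne
        (by rw [map_sub, hself, hnext, sub_self])
      have h1 : 0 ≤ g (Q k - Q (next k)) / G (next k) (Q k - Q (next k)) := by
        refine div_nonneg_of_nonpos ?_ hw.le
        have := hk k
        rw [map_sub]; linarith
      have h2 : 0 ≤ g (Q (next (next k)) - Q (next k)) /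
          G k (Q (next (next k)) - Q (next k)) := by
        refine div_nonneg_of_nonpos ?_ hu.le
        have := hk (next (next k))
        rw [map_sub]; linarith
      generalize g (Q k - Q (next k)) / G (next k) (Q k - Q (next k)) = p at *
      generalize g (Q (next (next k)) - Q (next k)) /
          G k (Q (next (next k)) - Q (next k)) = q at *
      have hle : g x ≤ g (Q (next k)) := by
        rw [hcomb]
        simp only [add_apply, smul_apply, smul_eq_mul,
          hself, hnext]
        have := mul_le_mul_of_nonneg_left (hG (next k) x hx) h1
        have := mul_le_mul_of_nonneg_left (hG k x hx) h2
        linarith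
      linarith [hgQ (next k)]
    · refine convexHull_min ?_ (hPc.linear_image π.toLinearMap)
      intro y hy
      simp only [Finset.coe_image, Finset.coe_univ, Set.image_univ, Set.mem_range] at hy
      obtain ⟨i, rfl⟩ := hy
      exact ⟨Q i, hQ i, rfl⟩

/-- An edge of a polyhedron casts an edge of the shadow exactly when one of the two faces at the
edge is turned towards the direction `v` and the other one away from it. A cyclic sequence of such
edges, running through the vertices `Q i`, is the boundary of the shadow. -/
theorem isConvexGon_polyhedronShadow_of_silhouette {ι κ : Type*} [Fintype ι] [Nonempty ι]
    (next : Equiv.Perm ι) (hn : ∀ i, next i ≠ i) (hnn : ∀ i, next (next i) ≠ i)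
    {v : E3} (n : κ → StrongDual ℝ E3) (b : κ → ℝ)
    (hPi : (interior {x | ∀ f, n f x ≤ b f}).Nonempty)
    (Q : ι → E3) (hQ : ∀ i f, n f (Q i) ≤ b f) (F F' : ι → κ)
    (hF : ∀ i, 0 < n (F i) v) (hF' : ∀ i, n (F' i) v < 0)
    (hinc : ∀ i j, (n (F i) (Q j) = b (F i) ∧ n (F' i) (Q j) = b (F' i)) ↔
      j = i ∨ j = next i) :
    IsConvexGon (Fintype.card ι) (polyhedronShadow v {x | ∀ f, n f x ≤ b f}) := by
  have hv : v ≠ 0 := by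
    rintro rfl
    simpa using hF (Classical.arbitrary ι)
  have hPc : Convex ℝ {x | ∀ f, n f x ≤ b f} := by
    rw [Set.ofPred_forall]
    exact convex_iInter fun f => convex_halfSpace_le (n f).isLinear _
  refine isConvexGon_polyhedronShadow_of_support next hn hnn hv hPc hPi Q hQ
    (fun i => (-n (F' i) v) • n (F i) + (n (F i) v) • n (F' i))
    (fun i => (-n (F' i) v) * b (F i) + (n (F i) v) * b (F' i)) ?_ ?_ ?_
  · intro i
    simp only [add_apply, smul_apply, smul_eq_mul]
    ring
  · intro i x hx
    simp only [add_apply, smul_apply, smul_eq_mul]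
    have := mul_le_mul_of_nonneg_left (hx (F i)) (neg_nonneg.2 (hF' i).le)
    have := mul_le_mul_of_nonneg_left (hx (F' i)) (hF i).le
    linarith
  · intro i j
    rw [← hinc]
    simp only [add_apply, smul_apply, smul_eq_mul]
    have h1 := mul_le_mul_of_nonneg_left (hQ j (F i)) (neg_nonneg.2 (hF' i).le)
    have h2 := mul_le_mul_of_nonneg_left (hQ j (F' i)) (hF i).le
    constructor
    · intro h
      exact ⟨mul_left_cancel₀ (neg_pos.2 (hF' i)).ne' (by linarith),
        mul_left_cancel₀ (hF i).ne' (by linarith)⟩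
    · rintro ⟨h, h'⟩
      rw [h, h']

theorem polyhedronShadow_neg (v : E3) (P : Set E3) :
    polyhedronShadow (-v) P = polyhedronShadow v P := by
  rw [polyhedronShadow, polyhedronShadow]
  congr 3
  simp only [← Set.neg_singleton, Submodule.span_neg]

/-! ### The truncated tetrahedron in coordinates -/

/-- Labels of the bounding half-spaces of an equitruncated tetrahedron: the top cut, the base, the
three remaining faces `coord i` of the tetrahedron (`coord i` is opposite to the `i`-th base
vertex), and the six side cuts. The cut `side i j` cuts off the `i`-th base vertex and is parallel
to the edge from the apex to the base vertex other than `i` and `j`; `side i i` is a dummy label,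
which stands for a vacuous condition. -/
inductive CutFace
  | top
  | base
  | coord (i : Fin 3)
  | side (i j : Fin 3)
  deriving DecidableEq, Fintype

/-- Labels of the fifteen vertices of an equitruncated tetrahedron: the three vertices of the top
cut, the three chosen points on the edges from the apex, the points where the three chosen lines
meet the base, and the points `corner i j` at which `side i k` (with `k` the third index) cuts the
base edge from the `i`-th to the `j`-th base vertex; `corner i i` is a dummy label. -/
inductive CutVertex
  | top (i : Fin 3)
  | edge (i : Fin 3)
  | foot (i : Fin 3)
  | corner (i j : Fin 3)

/-- The labels that stand for actual faces. -/
def CutFace.IsProper : CutFace → Bool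
  | .side i j => i ≠ j
  | _ => true

/-- The labels that stand for actual vertices. -/
def CutVertex.IsProper : CutVertex → Bool
  | .corner i j => i ≠ j
  | _ => true

/-- The incidence relation between the faces and the vertices. -/
def CutFace.incident : CutFace → CutVertex → Bool
  | .top, .top _ => true
  | .base, .foot _ => true
  | .base, .corner _ _ => true
  | .coord k, .top i => k ≠ i
  | .coord k, .edge i => k ≠ i
  | .coord k, .corner i j => k ≠ i ∧ k ≠ j
  | .side k l, .edge i => k = i ∧ l ≠ i
  | .side k l, .foot i => k = i ∧ l ≠ i
  | .side k l, .corner i j => k = i ∧ l ≠ i ∧ l ≠ j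
  | _, _ => false

/-- Coordinates for an equitruncated tetrahedron: the origin `O` is the apex, and the basis vectors
point along the edges at the apex and are scaled so that their sum has the common direction of the
three chosen lines and lies in the base. The base is `∑ i, w i * x i = 1`, the top cut is
`∑ i, w i * x i = t`, the chosen point on the `i`-th edge has `i`-th coordinate `a i`, and the side
cut `side i j` is `x i - x j = a i`. The last condition says that a part of each base edge
remains. -/
structure CutData where
  O : E3
  b : Module.Basis (Fin 3) ℝ E3
  w : Fin 3 → ℝ
  a : Fin 3 → ℝ
  t : ℝ
  w_pos : ∀ i, 0 < w i
  w_sum : ∑ i, w i = 1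
  t_pos : 0 < t
  t_lt : ∀ i, t < w i * a i
  lt_one : ∀ i, w i * a i < 1
  one_lt : ∀ i j, i ≠ j → 1 < w i * a i + w j * a j

namespace CutData

variable (D : CutData)

/-- The linear form of a bounding plane, as a function of the coordinates. -/
def form : CutFace → (Fin 3 → ℝ) → ℝ
  | .top, x => -∑ i, D.w i * x i
  | .base, x => ∑ i, D.w i * x i
  | .coord i, x => -x i
  | .side i j, x => x i - x j

/-- The bound on the linear form of a bounding plane, with the origin of coordinates at the apex. -/
def level : CutFace → ℝ
  | .top => -D.t
  | .base => 1
  | .coord _ => 0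
  | .side i _ => D.a i

/-- The coordinates of the vertices. -/
noncomputable def vertex : CutVertex → Fin 3 → ℝ
  | .top i => fun k => if k = i then D.t / D.w i else 0
  | .edge i => fun k => if k = i then D.a i else 0
  | .foot i => fun k => (if k = i then D.a i else 0) + (1 - D.w i * D.a i)
  | .corner i j => fun k =>
      if k = i then D.a i else if k = j then (1 - D.w i * D.a i) / D.w j else 0

theorem t_lt_one : D.t < 1 := (D.t_lt 0).trans (D.lt_one 0)

theorem a_pos (i : Fin 3) : 0 < D.a i :=
  pos_of_mul_pos_right (D.t_pos.trans (D.t_lt i)) (D.w_pos i).le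

theorem w_lt_one (i : Fin 3) : D.w i < 1 := by
  have h := D.w_sum
  rw [Fin.sum_univ_three] at h
  have := D.w_pos 0
  have := D.w_pos 1
  have := D.w_pos 2
  fin_cases i <;> simp only [Fin.zero_eta, Fin.mk_one, Fin.reduceFinMk] <;> linarith

/-- The cuts at the `j`-th base vertex leave the vertex `corner i j`, whose `j`-th coordinate is on
the left. -/
theorem corner_lt {i j : Fin 3} (h : i ≠ j) : (1 - D.w i * D.a i) / D.w j < D.a j := by
  rw [div_lt_iff₀ (D.w_pos j)]
  linarith [D.one_lt i j h]

theorem one_sub_lt {i j : Fin 3} (h : i ≠ j) : 1 - D.w i * D.a i < D.a j := by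
  have := mul_lt_mul_of_pos_right (D.w_lt_one j) (D.a_pos j)
  linarith [D.one_lt i j h]

theorem corner_pos (i j : Fin 3) : 0 < (1 - D.w i * D.a i) / D.w j :=
  div_pos (by linarith [D.lt_one i]) (D.w_pos j)

/-- The vertices `corner i j` lie in the base. -/
theorem form_base_corner {i j : Fin 3} (h : i ≠ j) :
    ∑ k, D.w k * D.vertex (.corner i j) k = 1 := by
  have hw (i) : D.w i ≠ 0 := (D.w_pos i).ne'
  fin_cases i <;> fin_cases j <;> simp_all [Fin.sum_univ_three, vertex, mul_div_cancel₀]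

theorem form_vertex_eq {f : CutFace} {V : CutVertex} (hV : V.IsProper)
    (h : f.incident V) : D.form f (D.vertex V) = D.level f := by
  have hw (i) : D.w i ≠ 0 := (D.w_pos i).ne'
  have hs := D.w_sum
  have hc := @D.form_base_corner
  cases f <;> cases V <;>
    simp_all [CutFace.incident, CutVertex.IsProper, form, vertex, level, mul_div_cancel₀, mul_add,
      Finset.sum_add_distrib, ← Finset.sum_mul]

theorem form_vertex_lt {f : CutFace} {V : CutVertex} (hV : V.IsProper)
    (h : ¬ f.incident V) : D.form f (D.vertex V) < D.level f := by
  have hw (i) : D.w i ≠ 0 := (D.w_pos i).ne'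
  have hs := D.w_sum
  have ht := D.t_lt
  have h1 := D.lt_one
  have h2 := D.t_lt_one
  have h3 := D.a_pos
  have h0 := D.t_pos
  have h4 (i) : 0 < D.t / D.w i := div_pos D.t_pos (D.w_pos i)
  have h5 (i) : D.t / D.w i < D.a i := by
    rw [div_lt_iff₀ (D.w_pos i)]
    linarith [D.t_lt i]
  cases f with
  | top =>
    cases V with
    | corner i j =>
      have := D.form_base_corner (i := i) (j := j) (by simpa [CutVertex.IsProper] using hV)
      simp only [form, level, this]
      linarith
    | _ =>
      simp_all [CutFace.incident, form, vertex, level, mul_add, Finset.sum_add_distrib,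
        ← Finset.sum_mul]
  | base =>
    cases V <;> simp_all [CutFace.incident, form, vertex, level, mul_div_cancel₀]
  | coord k =>
    cases V with
    | foot i =>
      simp only [form, vertex, level]
      split_ifs <;> linarith [h1 i, h3 i]
    | corner i j =>
      have := D.corner_pos i j
      simp_all [CutFace.incident, form, vertex, level]
      split_ifs <;> simp_all
    | _ => simp_all [CutFace.incident, form, vertex, level]
  | side k l =>
    cases V with
    | top i =>
      simp only [form, vertex, level]
      split_ifs <;> grind
    | corner i j =>
      have hij : i ≠ j := by simpa [CutVertex.IsProper] using hV
      have := D.corner_pos i j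
      have := D.corner_lt hij
      simp only [CutFace.incident, form, vertex, level] at h ⊢
      split_ifs <;> grind
    | _ i =>
      simp only [CutFace.incident, form, vertex, level] at h ⊢
      split_ifs <;> grind

/-! ### The polyhedron and its faces -/

/-- The outward normal functionals of the bounding planes. -/
noncomputable def normal : CutFace → StrongDual ℝ E3
  | .top => -∑ i, D.w i • (D.b.coord i).toContinuousLinearMap
  | .base => ∑ i, D.w i • (D.b.coord i).toContinuousLinearMap
  | .coord i => -(D.b.coord i).toContinuousLinearMap
  | .side i j => (D.b.coord i).toContinuousLinearMap - (D.b.coord j).toContinuousLinearMap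

/-- The bound on the outward normal functional of a bounding plane. -/
noncomputable def bound (f : CutFace) : ℝ := D.level f + D.normal f D.O

/-- The polyhedron described by the coordinates: the intersection of its half-spaces. -/
def solid : Set E3 := {x | ∀ f, D.normal f x ≤ D.bound f}

/-- The point with given coordinates. -/
noncomputable def point (x : Fin 3 → ℝ) : E3 := D.O + D.b.equivFun.symm x

theorem normal_apply (f : CutFace) (x : E3) : D.normal f x = D.form f (D.b.equivFun x) := by
  cases f <;> simp [normal, form]

theorem normal_point (f : CutFace) (x : Fin 3 → ℝ) :
    D.normal f (D.point x) = D.form f x + D.normal f D.O := by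
  rw [point, map_add, D.normal_apply f (D.b.equivFun.symm x), LinearEquiv.apply_symm_apply,
    add_comm]

/-- The line through the apex in the common direction of the chosen lines runs in the interior of the
polyhedron between the top cut and the base. -/
theorem form_diagonal_lt {s : ℝ} (h : D.t < s) (hs : s < 1) (f : CutFace) :
    D.form f (fun _ => s) < D.level f := by
  have := D.t_pos
  cases f <;> simp [form, level, ← Finset.sum_mul, D.w_sum, D.a_pos, h, hs]
  linarith

theorem isOpen_setOf_forall_normal_lt (p : CutFace → Prop) :
    IsOpen {x | ∀ f, p f → D.normal f x < D.bound f} := by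
  simp only [Set.ofPred_forall]
  exact isOpen_iInter_of_finite fun f => isOpen_iInter_of_finite fun _ =>
    isOpen_lt (D.normal f).continuous continuous_const

theorem exists_forall_normal_lt : ∃ x, ∀ f, D.normal f x < D.bound f := by
  obtain ⟨s, h, hs⟩ := exists_between D.t_lt_one
  refine ⟨D.point fun _ => s, fun f => ?_⟩
  rw [normal_point, bound]
  linarith [D.form_diagonal_lt h hs f]

theorem interior_solid_nonempty : (interior D.solid).Nonempty := by
  obtain ⟨x, hx⟩ := D.exists_forall_normal_lt
  exact ⟨x, mem_interior.2 ⟨_, fun y hy f => (hy f trivial).le,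
    D.isOpen_setOf_forall_normal_lt fun _ => True, fun f _ => hx f⟩⟩

/-- Each face has a point that lies on no other face. -/
theorem exists_form_eq_forall_lt {f : CutFace} (hf : f.IsProper) :
    ∃ x, D.form f x = D.level f ∧ ∀ g, g ≠ f → D.form g x < D.level g := by
  have ht := D.t_pos
  have ht1 := D.t_lt_one
  cases f with
  | top =>
    refine ⟨fun _ => D.t, by simp [form, level, ← Finset.sum_mul, D.w_sum], ?_⟩
    intro g hg
    cases g <;> simp_all [form, level, ← Finset.sum_mul, D.w_sum, D.a_pos]
  | base =>
    refine ⟨fun _ => 1, by simp [form, level, D.w_sum], ?_⟩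
    intro g hg
    cases g <;> simp_all [form, level, D.w_sum, D.a_pos]
  | coord i =>
    -- the two nonzero coordinates contribute equally, by an amount between `t / 2` and `1 / 2`
    have h0 : 0 < D.t / (1 + D.t) := by positivity
    have h1 : D.t / (1 + D.t) < D.t := div_lt_self ht (by linarith)
    have h2 : D.t < D.t / (1 + D.t) * 2 := by
      rw [div_mul_eq_mul_div, lt_div_iff₀ (by linarith)]
      nlinarith
    have h3 : D.t / (1 + D.t) * 2 < 1 := by
      rw [div_mul_eq_mul_div, div_lt_one (by linarith)]
      linarith
    generalize D.t / (1 + D.t) = r at *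
    have hw (k) : D.w k ≠ 0 := (D.w_pos k).ne'
    have hr (k) : 0 < r / D.w k := div_pos h0 (D.w_pos k)
    have hra (k) : r / D.w k < D.a k := by
      rw [div_lt_iff₀ (D.w_pos k)]
      linarith [D.t_lt k]
    have ha := D.a_pos
    have hsum : ∑ k, (if k = i then 0 else r) = r * 2 := by
      fin_cases i <;> simp [Fin.sum_univ_three] <;> ring
    refine ⟨fun k => if k = i then 0 else r / D.w k, by simp [form, level], ?_⟩
    intro g hg
    cases g with
    | side k l =>
      simp only [form, level]
      split_ifs <;> linarith [hr k, hr l, hra k, ha k]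
    | _ => simp_all [form, level, mul_div_cancel₀]
  | side i j =>
    have hij : i ≠ j := by simpa [CutFace.IsProper] using hf
    obtain ⟨r, hr⟩ : ∃ r, r = (1 - D.w i * D.a i) / 2 := ⟨_, rfl⟩
    have hwr (k) : D.w k * r < r := by
      have := D.w_lt_one k
      have : 0 < r := by linarith [D.lt_one i]
      nlinarith
    have h0 : 0 < r := by linarith [D.lt_one i]
    have hlt (k) (hk : k ≠ i) : r * 2 < D.a k := by
      linarith [D.one_sub_lt hk.symm]
    have ha := D.a_pos
    have hsum : ∑ k, D.w k * (if k = i then D.a i + r else if k = j then r else r * 2) =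
        D.w i * D.a i + r + (1 - D.w i - D.w j) * r := by
      have hs := D.w_sum
      rw [Fin.sum_univ_three] at hs ⊢
      fin_cases i <;> fin_cases j <;> simp_all <;> grind
    have hk1 : (1 - D.w i - D.w j) * r < r := by
      have := mul_pos (D.w_pos i) h0
      have := mul_pos (D.w_pos j) h0
      linarith
    have hk2 : 0 ≤ (1 - D.w i - D.w j) * r := by
      refine mul_nonneg ?_ h0.le
      have h := Finset.sum_le_univ_sum_of_nonneg (s := {i, j}) fun k => (D.w_pos k).le
      rw [Finset.sum_pair hij, D.w_sum] at h
      linarith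
    -- the chosen point on the `i`-th edge, moved inside the plane of the cut by an amount `r` so
    -- small that it satisfies all other conditions strictly
    refine ⟨fun k => if k = i then D.a i + r else if k = j then r else r * 2, ?_, ?_⟩
    · simp [form, level, hij.symm]
    · intro g hg
      cases g with
      | top =>
        simp only [form, level, hsum]
        linarith [D.t_lt i]
      | base =>
        simp only [form, level, hsum]
        linarith
      | coord k =>
        simp only [form, level]
        split_ifs <;> linarith [ha i]
      | side k l =>
        simp only [form, level]
        have := hlt k
        split_ifs <;> grind

theorem normal_ne_zero {f : CutFace} (hf : f.IsProper) : D.normal f ≠ 0 := by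
  intro h
  obtain ⟨x, hx, -⟩ := D.exists_form_eq_forall_lt hf
  obtain ⟨y, hy⟩ := D.exists_forall_normal_lt
  have h1 := D.normal_point f x
  have h2 := hy f
  rw [bound] at h2
  simp only [h, zero_apply] at h1 h2
  linarith

/-- The points of the polyhedron on a bounding plane form a face whose directions are all the
directions of the plane. -/
theorem vectorSpan_face {f : CutFace} (hf : f.IsProper) :
    vectorSpan ℝ {x ∈ D.solid | D.normal f x = D.bound f} = (D.normal f).ker := by
  apply le_antisymm
  · rw [vectorSpan_def, Submodule.span_le]
    rintro _ ⟨y, hy, z, hz, rfl⟩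
    simp [hy.2, hz.2]
  · obtain ⟨x, hx, hxg⟩ := D.exists_form_eq_forall_lt hf
    have hpf : D.normal f (D.point x) = D.bound f := by rw [normal_point, bound, hx]
    have hpg (g) (hg : g ≠ f) : D.normal g (D.point x) < D.bound g := by
      rw [normal_point, bound]
      linarith [hxg g hg]
    have hmem {y : E3} (hy : D.normal f y = D.bound f)
        (hy' : ∀ g, g ≠ f → D.normal g y < D.bound g) :
        y ∈ {x ∈ D.solid | D.normal f x = D.bound f} := by
      refine ⟨fun g => ?_, hy⟩
      by_cases hg : g = f
      · rw [hg, hy]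
      · exact (hy' g hg).le
    refine le_vectorSpan_of_forall_exists_add_smul_mem (hmem hpf hpg) fun u hu => ?_
    obtain ⟨ε, hε, h⟩ := exists_pos_add_smul_mem_of_mem_interior
      (S := {x | ∀ g, g ≠ f → D.normal g x < D.bound g}) (x := D.point x)
      (by rw [(D.isOpen_setOf_forall_normal_lt _).interior_eq]; exact hpg) u
    refine ⟨ε, hε, hmem ?_ h⟩
    have : D.normal f u = 0 := hu
    rw [map_add, map_smul, this, hpf, smul_zero, add_zero]

theorem isPolyhedronFace {f : CutFace} (hf : f.IsProper) :
    IsPolyhedronFace D.solid {x ∈ D.solid | D.normal f x = D.bound f} := by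
  constructor
  · rintro ⟨y, hy, hyf⟩
    refine ⟨D.normal f, ?_⟩
    ext x
    refine and_congr_right fun hx => ⟨fun h z hz => ?_, fun h => ?_⟩
    · rw [h]
      exact hz f
    · exact le_antisymm (hx f) (hyf ▸ h y hy)
  · rw [D.vectorSpan_face hf]
    have h := LinearMap.finrank_range_add_finrank_ker (D.normal f : E3 →ₗ[ℝ] ℝ)
    have hr : (D.normal f : E3 →ₗ[ℝ] ℝ).range = ⊤ := by
      rw [LinearMap.range_eq_top]
      apply LinearMap.surjective
      intro h0
      exact D.normal_ne_zero hf (ContinuousLinearMap.coe_injective h0)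
    rw [hr, finrank_top, Module.finrank_self, finrank_euclideanSpace_fin] at h
    omega

theorem isBounded_solid : Bornology.IsBounded D.solid := by
  have h : D.solid ⊆ D.point '' (Set.univ.pi fun i => Set.Icc 0 (1 / D.w i)) := by
    intro x hx
    refine ⟨D.b.equivFun (x - D.O), ?_, by rw [point, LinearEquiv.symm_apply_apply, add_sub_cancel]⟩
    have hform (f) : D.form f (D.b.equivFun (x - D.O)) ≤ D.level f := by
      have := hx f
      rw [bound] at this
      rw [← normal_apply, map_sub]
      linarith
    generalize D.b.equivFun (x - D.O) = y at hform
    have h0 (i) : 0 ≤ y i := by simpa [form, level] using hform (.coord i)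
    intro i _
    refine ⟨h0 i, ?_⟩
    rw [le_div_iff₀ (D.w_pos i), mul_comm]
    refine le_trans ?_ (hform .base)
    exact Finset.single_le_sum (f := fun k => D.w k * y k)
      (fun k _ => mul_nonneg (D.w_pos k).le (h0 k)) (Finset.mem_univ i)
  refine Bornology.IsBounded.subset (IsCompact.isBounded ?_) h
  refine (isCompact_univ_pi fun i => isCompact_Icc).image ?_
  exact continuous_const.add
    (LinearMap.continuous_of_finiteDimensional D.b.equivFun.symm.toLinearMap)

theorem isConvexPolyhedron_solid : IsConvexPolyhedron D.solid := by
  classical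
  refine ⟨⟨(Finset.univ.filter fun f : CutFace => f.IsProper).image
    fun f => (D.normal f, D.bound f), ?_, ?_⟩, D.isBounded_solid, D.interior_solid_nonempty⟩
  · intro h hh
    obtain ⟨f, hf, rfl⟩ := Finset.mem_image.1 hh
    exact D.normal_ne_zero (Finset.mem_filter.1 hf).2
  · ext x
    simp only [solid, Set.mem_ofPred_eq, Finset.mem_image, Finset.mem_filter, Finset.mem_univ,
      true_and, forall_exists_index, and_imp]
    constructor
    · rintro h _ f - rfl
      exact h f
    · intro h f
      by_cases hf : f.IsProper
      · exact h _ f hf rfl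
      · cases f with
        | side i j =>
          obtain rfl : i = j := by simpa [CutFace.IsProper] using hf
          simp [normal, bound, level, (D.a_pos i).le]
        | _ => simp [CutFace.IsProper] at hf

/-- A direction that is not parallel to a face is not parallel to a bounding plane. -/
theorem normal_apply_ne_zero {v : E3}
    (hv : ∀ F : Set E3, IsPolyhedronFace D.solid F → v ∉ vectorSpan ℝ F)
    {f : CutFace} (hf : f.IsProper) : D.normal f v ≠ 0 := by
  have := hv _ (D.isPolyhedronFace hf)
  rwa [D.vectorSpan_face hf] at this

end CutData

/-! ### The silhouette -/

namespace CutData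

variable (D : CutData)

/-- A cyclic sequence of ten edges, the `i`-th one joining the vertices `V i` and `V (i + 1)` and
separating the face `F i`, turned towards `v`, from the face `F' i`, turned away from `v`, is the
boundary of the shadow. -/
theorem isConvexGon_of_cycle {v : E3} (V : Fin 10 → CutVertex) (F F' : Fin 10 → CutFace)
    (hV : ∀ i, (V i).IsProper)
    (hinc : ∀ i j, ((F i).incident (V j) ∧ (F' i).incident (V j)) ↔ j = i ∨ j = i + 1)
    (hF : ∀ i, 0 < D.form (F i) (D.b.equivFun v))
    (hF' : ∀ i, D.form (F' i) (D.b.equivFun v) < 0) :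
    IsConvexGon 10 (polyhedronShadow v D.solid) := by
  have heq (f : CutFace) (j) : D.normal f (D.point (D.vertex (V j))) = D.bound f ↔
      f.incident (V j) := by
    rw [normal_point, bound, add_left_inj]
    refine ⟨fun h => ?_, D.form_vertex_eq (hV j)⟩
    by_contra h'
    exact (D.form_vertex_lt (hV j) h').ne h
  have hle (f : CutFace) (j) : D.normal f (D.point (D.vertex (V j))) ≤ D.bound f := by
    by_cases h : f.incident (V j)
    · exact ((heq f j).2 h).le
    · rw [normal_point, bound]
      linarith [D.form_vertex_lt (hV j) h]
  refine isConvexGon_polyhedronShadow_of_silhouette (Equiv.addRight (1 : Fin 10)) (by decide)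
    (by decide) D.normal D.bound D.interior_solid_nonempty
    (fun j => D.point (D.vertex (V j))) (fun j f => hle f j) F F' ?_ ?_ ?_
  · intro i
    rw [normal_apply]
    exact hF i
  · intro i
    rw [normal_apply]
    exact hF' i
  · intro i j
    rw [heq, heq, hinc]
    rfl

/-- The shadow in a direction with increasing coordinates whose weighted sum is positive. There
are three silhouettes, depending on the position of zero among the coordinates. -/
theorem isConvexGon_of_increasing {v : E3} (hs : 0 < ∑ i, D.w i * D.b.equivFun v i)
    (h01 : D.b.equivFun v 0 < D.b.equivFun v 1) (h12 : D.b.equivFun v 1 < D.b.equivFun v 2)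
    (h0 : D.b.equivFun v 0 ≠ 0) (h1 : D.b.equivFun v 1 ≠ 0) :
    IsConvexGon 10 (polyhedronShadow v D.solid) := by
  have h2 : 0 < D.b.equivFun v 2 := by
    by_contra! h
    refine hs.not_ge (Finset.sum_nonpos fun i _ => mul_nonpos_of_nonneg_of_nonpos (D.w_pos i).le ?_)
    fin_cases i <;> simp only [Fin.zero_eta, Fin.mk_one, Fin.reduceFinMk] <;> linarith
  rcases lt_or_gt_of_ne h0 with h0 | h0
  · rcases lt_or_gt_of_ne h1 with h1 | h1
    · refine D.isConvexGon_of_cycle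
        ![.corner 1 0, .corner 0 1, .foot 0, .corner 0 2, .edge 0, .top 0, .top 2, .top 1,
          .edge 1, .foot 1]
        ![.base, .base, .base, .coord 1, .coord 1, .coord 1, .coord 0, .coord 0, .side 1 0, .base]
        ![.coord 2, .side 0 2, .side 0 1, .side 0 1, .coord 2, .top, .top, .coord 2, .side 1 2,
          .side 1 2]
        (by decide) (by decide) ?_ ?_ <;> generalize D.b.equivFun v = y at * <;> intro i <;>
        fin_cases i <;> simp [form] <;> linarith
    · refine D.isConvexGon_of_cycle
        ![.corner 1 0, .corner 0 1, .foot 0, .corner 0 2, .corner 2 0, .edge 2, .top 2, .top 1,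
          .edge 1, .foot 1]
        ![.base, .base, .base, .base, .side 2 1, .coord 0, .coord 0, .coord 0, .side 1 0, .base]
        ![.coord 2, .side 0 2, .side 0 1, .coord 1, .coord 1, .coord 1, .top, .coord 2, .side 1 2,
          .side 1 2]
        (by decide) (by decide) ?_ ?_ <;> generalize D.b.equivFun v = y at * <;> intro i <;>
        fin_cases i <;> simp [form] <;> linarith
  · refine D.isConvexGon_of_cycle
      ![.corner 1 0, .corner 0 1, .foot 0, .corner 0 2, .corner 2 0, .edge 2, .corner 2 1,
        .corner 1 2, .edge 1, .foot 1]
      ![.base, .base, .base, .base, .side 2 1, .side 2 0, .base, .side 1 0, .side 1 0, .base]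
      ![.coord 2, .side 0 2, .side 0 1, .coord 1, .coord 1, .coord 0, .coord 0, .coord 0,
        .side 1 2, .side 1 2]
      (by decide) (by decide) ?_ ?_ <;> generalize D.b.equivFun v = y at * <;> intro i <;>
      fin_cases i <;> simp [form] <;> linarith

/-! ### Symmetry -/

theorem mem_solid {x : E3} : x ∈ D.solid ↔
    D.t ≤ ∑ i, D.w i * D.b.repr (x - D.O) i ∧ ∑ i, D.w i * D.b.repr (x - D.O) i ≤ 1 ∧
      (∀ i, 0 ≤ D.b.repr (x - D.O) i) ∧
      ∀ i j, D.b.repr (x - D.O) i - D.b.repr (x - D.O) j ≤ D.a i := by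
  have h (f) : D.normal f x ≤ D.bound f ↔ D.form f (D.b.equivFun (x - D.O)) ≤ D.level f := by
    rw [bound, ← normal_apply, map_sub, sub_le_iff_le_add]
  simp only [solid, Set.mem_ofPred_eq, h]
  constructor
  · intro h
    refine ⟨?_, ?_, fun i => ?_, fun i j => ?_⟩
    · simpa [form, level] using h .top
    · simpa [form, level] using h .base
    · simpa [form, level] using h (.coord i)
    · simpa [form, level] using h (.side i j)
  · rintro ⟨h1, h2, h3, h4⟩ (_ | _ | i | ⟨i, j⟩)
    · simpa [form, level] using h1
    · simpa [form, level] using h2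
    · simpa [form, level] using h3 i
    · simpa [form, level] using h4 i j

/-- The same polyhedron with the base vertices listed in another order. -/
noncomputable def reindex (σ : Equiv.Perm (Fin 3)) : CutData where
  O := D.O
  b := D.b.reindex σ.symm
  w := D.w ∘ σ
  a := D.a ∘ σ
  t := D.t
  w_pos i := D.w_pos (σ i)
  w_sum := (Equiv.sum_comp σ D.w).trans D.w_sum
  t_pos := D.t_pos
  t_lt i := D.t_lt (σ i)
  lt_one i := D.lt_one (σ i)
  one_lt i j h := D.one_lt (σ i) (σ j) (σ.injective.ne h)

theorem repr_reindex (σ : Equiv.Perm (Fin 3)) (x : E3) (i : Fin 3) :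
    (D.reindex σ).b.repr x i = D.b.repr x (σ i) := by
  simp [reindex]

theorem solid_reindex (σ : Equiv.Perm (Fin 3)) : (D.reindex σ).solid = D.solid := by
  ext x
  simp only [mem_solid, repr_reindex]
  simp only [reindex, Function.comp_apply]
  rw [Equiv.sum_comp σ fun i => D.w i * D.b.repr (x - D.O) i,
    σ.forall_congr_right (q := fun i => 0 ≤ D.b.repr (x - D.O) i),
    σ.forall_congr_right
      (q := fun i => ∀ j, D.b.repr (x - D.O) i - D.b.repr (x - D.O) (σ j) ≤ D.a i)]
  simp only [fun i => σ.forall_congr_right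
    (q := fun j => D.b.repr (x - D.O) i - D.b.repr (x - D.O) j ≤ D.a i)]

theorem isConvexGon_of_sum_pos {v : E3}
    (hv : ∀ F : Set E3, IsPolyhedronFace D.solid F → v ∉ vectorSpan ℝ F)
    (hs : 0 < ∑ i, D.w i * D.b.equivFun v i) :
    IsConvexGon 10 (polyhedronShadow v D.solid) := by
  have hcoord (i) : D.b.equivFun v i ≠ 0 := by
    have := D.normal_apply_ne_zero hv (f := .coord i) rfl
    rw [normal_apply] at this
    simpa [form] using this
  have hne {i j} (h : i ≠ j) : D.b.equivFun v i ≠ D.b.equivFun v j := by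
    have := D.normal_apply_ne_zero hv (f := .side i j) (by simpa [CutFace.IsProper] using h)
    rw [normal_apply] at this
    simpa [form, sub_eq_zero] using this
  set σ := Tuple.sort (D.b.equivFun v) with hσ
  have hmono : StrictMono (D.b.equivFun v ∘ σ) :=
    (Tuple.monotone_sort _).strictMono_of_injective fun i j h => by
      by_contra hij
      exact hne (σ.injective.ne hij) h
  rw [← D.solid_reindex σ]
  have hr (i) : (D.reindex σ).b.equivFun v i = D.b.equivFun v (σ i) := D.repr_reindex σ v i
  refine (D.reindex σ).isConvexGon_of_increasing ?_ ?_ ?_ ?_ ?_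
  · simp only [hr]
    exact hs.trans_eq (Equiv.sum_comp σ fun i => D.w i * D.b.equivFun v i).symm
  · rw [hr, hr]
    exact hmono (by decide)
  · rw [hr, hr]
    exact hmono (by decide)
  · rw [hr]
    exact hcoord _
  · rw [hr]
    exact hcoord _

theorem isEquiprojective_solid : IsEquiprojective 10 D.solid := by
  refine ⟨D.isConvexPolyhedron_solid, fun v _ hv => ?_⟩
  have h := D.normal_apply_ne_zero hv (f := .base) rfl
  rw [normal_apply] at h
  rcases lt_or_gt_of_ne h with h | h
  · rw [← polyhedronShadow_neg]
    refine D.isConvexGon_of_sum_pos (fun F hF hv' => hv F hF (neg_mem_iff.1 hv')) ?_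
    simpa [form] using h
  · exact D.isConvexGon_of_sum_pos hv h

end CutData

/-! ### Coordinates for an equitruncated tetrahedron -/

/-- The points cut off by a plane that is the zero set of a functional are those at which the
functional has the same sign as at the point cut off. -/
theorem mem_cutOff_iff {Q : AffineSubspace ℝ E3} {n : E3 →ₗ[ℝ] ℝ} {p : E3}
    (hQ : ∀ y, y ∈ Q ↔ n (y - p) = 0) {v x : E3} :
    x ∈ cutOff Q v ↔ 0 < n (v - p) * n (x - p) := by
  rw [cutOff, Set.mem_ofPred_eq, AffineSubspace.SSameSide, hQ, hQ]
  constructor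
  · rintro ⟨⟨p₁, h₁, p₂, h₂, h⟩, hv, hx⟩
    have hs := h.map n
    rw [hQ] at h₁ h₂
    have e₁ : n (v -ᵥ p₁) = n (v - p) := by
      rw [vsub_eq_sub, ← sub_sub_sub_cancel_right v p₁ p, map_sub, h₁, sub_zero]
    have e₂ : n (x -ᵥ p₂) = n (x - p) := by
      rw [vsub_eq_sub, ← sub_sub_sub_cancel_right x p₂ p, map_sub, h₂, sub_zero]
    rw [e₁, e₂] at hs
    obtain ⟨r, hr, h⟩ := hs.exists_pos_left hv hx
    rw [← h, smul_eq_mul, mul_left_comm]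
    exact mul_pos hr (mul_self_pos.2 hv)
  · intro h
    have hv : n (v - p) ≠ 0 := left_ne_zero_of_mul h.ne'
    have hx : n (x - p) ≠ 0 := right_ne_zero_of_mul h.ne'
    have hr : 0 < n (x - p) / n (v - p) := by
      rw [div_pos_iff, ← mul_pos_iff, mul_comm]
      exact h
    refine ⟨⟨p, by simp [hQ], x - (n (x - p) / n (v - p)) • (v - p), ?_, ?_⟩, hv, hx⟩
    · rw [hQ, sub_right_comm, map_sub, map_smul, smul_eq_mul, div_mul_cancel₀ _ hv, sub_self]
    · rw [vsub_eq_sub, vsub_eq_sub, sub_sub_cancel]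
      exact SameRay.sameRay_pos_smul_right _ hr

section Basis

variable (e : Module.Basis (Fin 3) ℝ E3)

theorem mem_sidePlane_iff {i j k : Fin 3} (hij : i ≠ j) (hik : i ≠ k) (hjk : j ≠ k) {O p d : E3}
    (hi : e.repr d i ≠ 0) (y : E3) :
    y ∈ sidePlane O (O + e k) p d ↔
      (e.repr d j • e.coord i - e.repr d i • e.coord j) (y - p) = 0 := by
  rw [sidePlane, AffineSubspace.mem_mk', vsub_eq_sub, add_sub_cancel_left,
    Submodule.mem_span_pair]
  constructor
  · rintro ⟨r, s, h⟩
    rw [← h]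
    simp [hik.symm, hjk.symm]
    ring
  · intro h
    refine ⟨e.repr (y - p) i / e.repr d i,
      e.repr (y - p) k - e.repr (y - p) i / e.repr d i * e.repr d k, ?_⟩
    generalize y - p = z at h
    simp only [LinearMap.sub_apply, LinearMap.smul_apply, Module.Basis.coord_apply,
      smul_eq_mul] at h
    apply e.ext_elem
    intro l
    have hl : l = i ∨ l = j ∨ l = k := by omega
    rcases hl with rfl | rfl | rfl
    · simp [hik.symm, hi]
    · simp [hjk.symm]
      field_simp
      linarith
    · simp

/-- The part of space that a side cut leaves. Dividing the coordinates by `w` makes all components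
of the direction of the chosen lines equal, so that the side cuts become differences of two
coordinates. -/
theorem notMem_cutOff_sidePlane_iff {i j k : Fin 3} (hij : i ≠ j) (hik : i ≠ k) (hjk : j ≠ k)
    {O d : E3} {κ : ℝ} {w : Fin 3 → ℝ} (hκ : κ ≠ 0) (hw : ∀ i, 0 < w i)
    (hd : ∀ i, e.repr d i = κ * w i) {r : ℝ} (hr : r < 1) (x : E3) :
    x ∉ cutOff (sidePlane O (O + e k) (O + r • e i) d) (O + e i) ↔
      e.repr (x - O) i / w i - e.repr (x - O) j / w j ≤ r / w i := by
  have hi : e.repr d i ≠ 0 := by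
    rw [hd]
    exact mul_ne_zero hκ (hw i).ne'
  rw [mem_cutOff_iff (mem_sidePlane_iff e hij hik hjk hi), not_lt]
  have h1 : O + e i - (O + r • e i) = (1 - r) • e i := by module
  have h2 : x - (O + r • e i) = x - O - r • e i := by module
  rw [h1, h2]
  generalize x - O = z
  have hp : 0 < κ * κ * (1 - r) * w j * (w i * w j) := by
    have := mul_self_pos.2 hκ
    have := hw i
    have := hw j
    have : 0 < 1 - r := by linarith
    positivity
  have key : (e.repr d j • e.coord i - e.repr d i • e.coord j) ((1 - r) • e i) *
      (e.repr d j • e.coord i - e.repr d i • e.coord j) (z - r • e i) =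
      (κ * κ * (1 - r) * w j * (w i * w j)) *
        (e.repr z i / w i - e.repr z j / w j - r / w i) := by
    have := (hw i).ne'
    have := (hw j).ne'
    simp [hd, hij]
    field_simp
    ring
  rw [key, mul_nonpos_iff_pos_imp_nonpos]
  constructor
  · intro h
    linarith [h.1 hp]
  · intro h
    exact ⟨fun _ => by linarith, fun _ => hp.le⟩

theorem mem_topPlane_iff {O T : E3} (y : E3) :
    y ∈ topPlane (O + e 0) (O + e 1) (O + e 2) T ↔
      (e.coord 0 + e.coord 1 + e.coord 2) (y - T) = 0 := by
  rw [topPlane, AffineSubspace.mem_mk', vsub_eq_sub, add_sub_add_left_eq_sub,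
    add_sub_add_left_eq_sub, Submodule.mem_span_pair]
  constructor
  · rintro ⟨r, s, h⟩
    rw [← h]
    simp
  · intro h
    refine ⟨e.repr (y - T) 1, e.repr (y - T) 2, ?_⟩
    generalize y - T = z at h
    simp only [LinearMap.add_apply, Module.Basis.coord_apply] at h
    apply e.ext_elem
    intro l
    fin_cases l
    · simp
      linarith
    · simp
    · simp

theorem notMem_cutOff_topPlane_iff {O : E3} {t : ℝ} (ht : 0 < t) (x : E3) :
    x ∉ cutOff (topPlane (O + e 0) (O + e 1) (O + e 2) (O + t • e 0)) O ↔
      t ≤ ∑ i, e.repr (x - O) i := by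
  rw [mem_cutOff_iff (mem_topPlane_iff e), not_lt]
  have h1 : O - (O + t • e 0) = -(t • e 0) := by module
  have h2 : x - (O + t • e 0) = x - O - t • e 0 := by module
  rw [h1, h2, Fin.sum_univ_three]
  generalize x - O = z
  have key : (e.coord 0 + e.coord 1 + e.coord 2) (-(t • e 0)) *
      (e.coord 0 + e.coord 1 + e.coord 2) (z - t • e 0) =
      t * (t - (e.repr z 0 + e.repr z 1 + e.repr z 2)) := by
    simp
    ring
  rw [key]
  constructor
  · intro h
    by_contra! h'
    exact h.not_gt (mul_pos ht (sub_pos.2 h'))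
  · intro h
    exact mul_nonpos_of_nonneg_of_nonpos ht.le (by linarith)

theorem mem_convexHull_iff_repr {O x : E3} :
    x ∈ convexHull ℝ {O, O + e 0, O + e 1, O + e 2} ↔
      (∀ i, 0 ≤ e.repr (x - O) i) ∧ ∑ i, e.repr (x - O) i ≤ 1 := by
  constructor
  · intro hx
    have hc : Convex ℝ {x | (∀ i, 0 ≤ e.repr (x - O) i) ∧ ∑ i, e.repr (x - O) i ≤ 1} := by
      rintro x ⟨hx, hx'⟩ y ⟨hy, hy'⟩ r s hr hs hrs
      have h : r • x + s • y - O = r • (x - O) + s • (y - O) := by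
        obtain rfl : s = 1 - r := by linarith
        module
      simp only [Set.mem_ofPred_eq, h, map_add, map_smul, Finsupp.add_apply, Finsupp.smul_apply,
        smul_eq_mul]
      refine ⟨fun i => add_nonneg (mul_nonneg hr (hx i)) (mul_nonneg hs (hy i)), ?_⟩
      rw [Finset.sum_add_distrib, ← Finset.mul_sum, ← Finset.mul_sum]
      nlinarith
    refine convexHull_min ?_ hc hx
    have h (k) : O + e k ∈ {x | (∀ i, 0 ≤ e.repr (x - O) i) ∧ ∑ i, e.repr (x - O) i ≤ 1} := by
      simp only [Set.mem_ofPred_eq, add_sub_cancel_left, Module.Basis.repr_self,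
        Finsupp.single_apply]
      refine ⟨fun i => by split_ifs <;> norm_num, by simp⟩
    rintro y (rfl | rfl | rfl | rfl)
    · simp
    all_goals exact h _
  · rintro ⟨h0, h1⟩
    have hs := (convex_convexHull ℝ {O, O + e 0, O + e 1, O + e 2}).sum_mem
      (t := Finset.univ)
      (w := ![1 - ∑ i, e.repr (x - O) i, e.repr (x - O) 0, e.repr (x - O) 1, e.repr (x - O) 2])
      (z := ![O, O + e 0, O + e 1, O + e 2]) ?_ ?_ ?_
    · convert hs using 1
      have hx := e.sum_repr (x - O)
      rw [Fin.sum_univ_three, eq_sub_iff_add_eq] at hx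
      simp only [Fin.sum_univ_four, Fin.sum_univ_three, Matrix.cons_val]
      conv_lhs => rw [← hx]
      module
    · intro i _
      fin_cases i
      · simpa using h1
      all_goals exact h0 _
    · simp [Fin.sum_univ_four, Fin.sum_univ_three]
      ring
    · intro i _
      apply subset_convexHull
      fin_cases i <;> simp

/-- If the line with direction `d` through a point of the `i`-th edge meets the base, then the
components of `d` along the other two edges have the sign of the sum of all components: both are
positive multiples of the parameter of the point in the base. -/
theorem repr_div_sum_pos {i j : Fin 3} (hij : j ≠ i) {O d : E3} {r : ℝ} (hr : r < 1)
    (h : LineMeetsBase (O + e 0) (O + e 1) (O + e 2) (O + r • e i) d) :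
    0 < e.repr d j / ∑ k, e.repr d k := by
  obtain ⟨s, u, v, w, hu, hv, hw, hsum, h⟩ := h
  have hpos (k) : 0 < ![u, v, w] k := by fin_cases k <;> assumption
  have hc (k) : (if i = k then r else 0) + s * e.repr d k = ![u, v, w] k := by
    have hO : u • (O + e 0) + v • (O + e 1) + w • (O + e 2) =
        O + (u • e 0 + v • e 1 + w • e 2) := by
      rw [show u = 1 - v - w by linarith]
      module
    rw [hO, add_assoc, add_left_cancel_iff] at h
    have := congrArg (fun z => e.repr z k) h
    simp [Finsupp.single_apply] at this
    rw [this]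
    fin_cases k <;> simp
  have hj : 0 < s * e.repr d j := by
    have := hc j
    rw [if_neg hij.symm, zero_add] at this
    rw [this]
    exact hpos j
  have ht : 0 < s * ∑ k, e.repr d k := by
    have h1 : ∑ k, ((if i = k then r else 0) + s * e.repr d k) = 1 := by
      simp only [hc, Fin.sum_univ_three, Matrix.cons_val]
      exact hsum
    rw [Finset.sum_add_distrib, ← Finset.mul_sum, Finset.sum_ite_eq, if_pos (Finset.mem_univ i)]
      at h1
    linarith
  have hs : s ≠ 0 := left_ne_zero_of_mul hj.ne'
  rw [← mul_div_mul_left _ _ hs]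
  exact div_pos hj ht

theorem truncatedTetrahedron_eq_solid {O d : E3} {t : ℝ} {r : Fin 3 → ℝ} (D : CutData)
    (hr : ∀ i, r i < 1) (ht : 0 < t) {κ : ℝ} (hκ : κ ≠ 0) (hO : D.O = O) (hDt : D.t = t)
    (hd : ∀ i, e.repr d i = κ * D.w i)
    (hb : ∀ x i, D.b.repr x i = e.repr x i / D.w i) (ha : ∀ i, D.a i = r i / D.w i) :
    truncatedTetrahedron O (O + e 0) (O + e 1) (O + e 2) (O + t • e 0) (O + r 0 • e 0)
      (O + r 1 • e 1) (O + r 2 • e 2) d = D.solid := by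
  subst hO hDt
  ext x
  have hsum : ∑ i, D.w i * D.b.repr (x - D.O) i = ∑ i, e.repr (x - D.O) i := by
    refine Finset.sum_congr rfl fun i _ => ?_
    rw [hb, mul_div_cancel₀ _ (D.w_pos i).ne']
  have hnn (i) : 0 ≤ D.b.repr (x - D.O) i ↔ 0 ≤ e.repr (x - D.O) i := by
    rw [hb, le_div_iff₀ (D.w_pos i), zero_mul]
  have hside {i j k : Fin 3} (hij : i ≠ j) (hik : i ≠ k) (hjk : j ≠ k) :=
    notMem_cutOff_sidePlane_iff e hij hik hjk hκ D.w_pos hd (hr i) x (O := D.O)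
  rw [truncatedTetrahedron, Set.mem_sdiff, D.mem_solid, mem_convexHull_iff_repr]
  simp only [Set.mem_union, not_or]
  rw [notMem_cutOff_topPlane_iff e ht, hsum, hside (i := 0) (j := 1) (k := 2),
    hside (i := 1) (j := 0) (k := 2), hside (i := 0) (j := 2) (k := 1),
    hside (i := 2) (j := 0) (k := 1), hside (i := 1) (j := 2) (k := 0),
    hside (i := 2) (j := 1) (k := 0)]
  · simp only [hnn, ← hb, ← ha]
    have hdiag (i) : D.b.repr (x - D.O) i - D.b.repr (x - D.O) i ≤ D.a i := by
      rw [sub_self]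
      exact (D.a_pos i).le
    rw [Fin.forall_fin_succ
      (P := fun i => ∀ j, D.b.repr (x - D.O) i - D.b.repr (x - D.O) j ≤ D.a i)]
    simp only [Fin.forall_fin_succ, IsEmpty.forall_iff, and_true, Fin.succ_zero_eq_one,
      Fin.succ_one_eq_two, hdiag, true_and]
    tauto
  all_goals decide

/-- On the base edge from the `i`-th to the `j`-th vertex, the cut at the `i`-th vertex that is
parallel to the edge from the apex to the `j`-th vertex, and the same with `i` and `j` exchanged,
leave the points with barycentric coordinates at most `r` and `s`. If more than one point is left,
then `r + s` exceeds `1`. -/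
theorem one_lt_add_of_nontrivial {i j k : Fin 3} (hij : i ≠ j) (hik : i ≠ k) (hjk : j ≠ k)
    {O d : E3} {κ : ℝ} {w : Fin 3 → ℝ} (hκ : κ ≠ 0) (hw : ∀ i, 0 < w i)
    (hd : ∀ i, e.repr d i = κ * w i) {r s : ℝ} (hr : r < 1) (hs : s < 1) {P : Set E3}
    (hP : ∀ x ∈ P, x ∉ cutOff (sidePlane O (O + e j) (O + r • e i) d) (O + e i))
    (hP' : ∀ x ∈ P, x ∉ cutOff (sidePlane O (O + e i) (O + s • e j) d) (O + e j))
    (h : (segment ℝ (O + e i) (O + e j) ∩ P).Nontrivial) : 1 < r + s := by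
  have key : ∀ x ∈ segment ℝ (O + e i) (O + e j) ∩ P, ∃ p q : ℝ, p + q = 1 ∧ p ≤ r ∧ q ≤ s ∧
      p • (O + e i) + q • (O + e j) = x := by
    rintro _ ⟨⟨p, q, -, -, hpq, rfl⟩, hx⟩
    have h1 := hP _ hx
    have h2 := hP' _ hx
    rw [notMem_cutOff_sidePlane_iff e hik hij hjk.symm hκ hw hd hr] at h1
    rw [notMem_cutOff_sidePlane_iff e hjk hij.symm hik.symm hκ hw hd hs] at h2
    have hz : p • (O + e i) + q • (O + e j) - O = p • e i + q • e j := by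
      rw [show q = 1 - p by linarith]
      module
    rw [hz] at h1 h2
    simp [hij, hij.symm, hik, hjk] at h1 h2
    rw [div_le_div_iff_of_pos_right (hw _)] at h1 h2
    exact ⟨p, q, hpq, h1, h2, rfl⟩
  obtain ⟨x, hx, y, hy, hxy⟩ := h
  obtain ⟨p, q, hpq, hp, hq, rfl⟩ := key x hx
  obtain ⟨p', q', hpq', hp', hq', rfl⟩ := key y hy
  by_contra! hle
  obtain rfl : p = p' := by linarith
  obtain rfl : q = q' := by linarith
  exact hxy rfl

end Basis

theorem exists_basis_of_affineIndependent {O A B C : E3}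
    (h : AffineIndependent ℝ ![O, A, B, C]) :
    ∃ e : Module.Basis (Fin 3) ℝ E3, A = O + e 0 ∧ B = O + e 1 ∧ C = O + e 2 := by
  rw [affineIndependent_iff_linearIndependent_vsub ℝ _ (0 : Fin 4)] at h
  have hli := h.comp (fun i : Fin 3 => ⟨i.succ, Fin.succ_ne_zero i⟩) fun i j hij => by
    simpa using hij
  refine ⟨basisOfLinearIndependentOfCardEqFinrank hli (by simp), ?_⟩
  simp [coe_basisOfLinearIndependentOfCardEqFinrank]

theorem exists_eq_add_smul_of_mem_openSegment {O u p : E3} {t : ℝ} (ht : t < 1)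
    (hp : p ∈ openSegment ℝ (AffineMap.lineMap O (O + u) t) (O + u)) :
    ∃ r, t < r ∧ r < 1 ∧ p = O + r • u := by
  obtain ⟨x, y, hx, hy, hxy, rfl⟩ := hp
  refine ⟨x * t + y, by nlinarith, by nlinarith, ?_⟩
  rw [AffineMap.lineMap_apply, vsub_eq_sub, vadd_eq_add, add_sub_cancel_left]
  obtain rfl : y = 1 - x := by linarith
  module

theorem IsEquitruncatedTetrahedron.exists_eq_solid {P : Set E3}
    (hP : IsEquitruncatedTetrahedron P) : ∃ D : CutData, P = D.solid := by
  obtain ⟨O, A, B, C, t, pa, pb, pc, d, hABC, ht, ht1, hpa, hpb, hpc, -, hla, hlb, hlc, hPeq, hAB,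
    hAC, hBC⟩ := hP
  obtain ⟨e, rfl, rfl, rfl⟩ := exists_basis_of_affineIndependent hABC
  obtain ⟨α, hα, hα1, rfl⟩ := exists_eq_add_smul_of_mem_openSegment ht1 hpa
  obtain ⟨β, hβ, hβ1, rfl⟩ := exists_eq_add_smul_of_mem_openSegment ht1 hpb
  obtain ⟨γ, hγ, hγ1, rfl⟩ := exists_eq_add_smul_of_mem_openSegment ht1 hpc
  obtain ⟨κ, hκd⟩ : ∃ κ, κ = ∑ k, e.repr d k := ⟨_, rfl⟩
  obtain ⟨w, hwd⟩ : ∃ w : Fin 3 → ℝ, w = fun k => e.repr d k / κ := ⟨_, rfl⟩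
  have hw (i) : 0 < w i := by
    rw [hwd, hκd]
    fin_cases i
    · exact repr_div_sum_pos e (by decide) hβ1 hlb
    · exact repr_div_sum_pos e (by decide) hα1 hla
    · exact repr_div_sum_pos e (by decide) hα1 hla
  have hκ : κ ≠ 0 := by
    rintro rfl
    have := hw 0
    simp [hwd] at this
  have hd (i) : e.repr d i = κ * w i := by rw [hwd, mul_div_cancel₀ _ hκ]
  have hmem {x} (hx : x ∈ P) := by
    have h := hx
    rw [hPeq, truncatedTetrahedron, Set.mem_sdiff] at h
    simp only [Set.mem_union, not_or] at h
    exact h.2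
  have hαβ : 1 < α + β := one_lt_add_of_nontrivial e (i := 0) (j := 1) (k := 2) (by decide)
    (by decide) (by decide) hκ hw hd hα1 hβ1 (fun x hx => (hmem hx).1.2.1)
    (fun x hx => (hmem hx).2.1) hAB
  have hαγ : 1 < α + γ := one_lt_add_of_nontrivial e (i := 0) (j := 2) (k := 1) (by decide)
    (by decide) (by decide) hκ hw hd hα1 hγ1 (fun x hx => (hmem hx).1.1.2.1)
    (fun x hx => (hmem hx).2.2) hAC
  have hβγ : 1 < β + γ := one_lt_add_of_nontrivial e (i := 1) (j := 2) (k := 0) (by decide)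
    (by decide) (by decide) hκ hw hd hβ1 hγ1 (fun x hx => (hmem hx).1.1.2.2)
    (fun x hx => (hmem hx).1.2.2) hBC
  have hmul (i) : w i * (![α, β, γ] i / w i) = ![α, β, γ] i := mul_div_cancel₀ _ (hw i).ne'
  have hlt (i) : ![α, β, γ] i < 1 := by fin_cases i <;> assumption
  let D : CutData :=
    { O := O
      b := e.isUnitSMul fun i => (hw i).ne'.isUnit
      w := w
      a := fun i => ![α, β, γ] i / w i
      t := t
      w_pos := hw
      w_sum := by simp only [hwd, ← Finset.sum_div, ← hκd, div_self hκ]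
      t_pos := ht
      t_lt := fun i => by
        rw [hmul]
        fin_cases i <;> assumption
      lt_one := fun i => by
        rw [hmul]
        exact hlt i
      one_lt := fun i j hij => by
        rw [hmul, hmul]
        fin_cases i <;> fin_cases j <;> simp at hij ⊢ <;> linarith }
  refine ⟨D, ?_⟩
  rw [hPeq, ← truncatedTetrahedron_eq_solid e (O := O) (d := d) (t := t) (r := ![α, β, γ]) D hlt ht
    hκ rfl rfl hd ?_ fun i => rfl]
  · simp [AffineMap.lineMap_apply, add_comm]
  · intro x i
    simp only [D, Module.Basis.repr_isUnitSMul]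
    rw [Units.smul_def, smul_eq_mul, div_eq_inv_mul, Units.val_inv_eq_inv_val, IsUnit.unit_spec]

theorem mainTheorem2 (P' : Set E3) (hP' : IsEquitruncatedTetrahedron P') :
    IsEquiprojective 10 P' := by
  obtain ⟨D, rfl⟩ := hP'.exists_eq_solid
  exact D.isEquiprojective_solid
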